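/- Let $N\ge 1$, $s\ge 0$, $r,p$ be fixed integers, let $A_{\ell,\sigma}\in\mathcal M_N(\mathbb R)$ ($-r\le\ell\le p$, $0\le\sigma\le s$), and let the ratio $\lambda=\Delta t/\Delta x>0$ be fixed. Let $Q_\sigma:=\sum_{\ell=-r}^{p}A_{\ell,\sigma}\,\mathbf T^\ell$, where $(\mathbf T^\ell v)_j:=v_{j+\ell}$, let $\widehat{Q_\sigma}(\kappa):=\sum_{\ell=-r}^{p}\kappa^\ell A_{\ell,\sigma}$, and for $\kappa\in\mathbb C\setminus\{0\}$ consider the amplification matrix $$\mathcal A(\kappa):=\begin{pmatrix}\widehat{Q_0}(\kappa)&\cdots&\cdots&\widehat{Q_s}(\kappa)\\ I&0&\cdots&0\\ 0&\ddots&\ddots&\vdots\\ 0&0&I&0\end{pmatrix}\in\mathcal M_{N(s+1)}(\mathbb C).$$ Assume: (1) (Stability) There is $C>0$ such that $\|\mathcal A(e^{i\eta})^n\|\le C$ for all $n\in\mathbb N$ and $\eta\in\mathbb R$. (2) (Geometric regularity) Whenever $|\underline\kappa|=1$ and $\underline z$ with $|\underline z|=1$ is an eigenvalue of $\mathcal A(\underline\kappa)$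 of algebraic multiplicity $\underline\alpha$, there are functions $\zeta_1,\dots,\zeta_{\underline\alpha}$, holomorphic in a neighborhood $\mathcal W\subset\mathbb C\setminus\{0\}$ of $\underline\kappa$, such that $\zeta_1(\underline\kappa)=\dots=\zeta_{\underline\alpha}(\underline\kappa)=\underline z$ and $$\det\big(zI-\mathcal A(\kappa)\big)=\vartheta(\kappa,z)\prod_{k=1}^{\underline\alpha}\big(z-\zeta_k(\kappa)\big)$$ near $(\underline\kappa,\underline z)$, with $\vartheta$ holomorphic near $(\underline\kappa,\underline z)$ and $\vartheta(\underline\kappa,\underline z)\ne0$; and there are vectors $e_1(\kappa),\dots,e_{\underline\alpha}(\kappa)\in\mathbb C^{N(s+1)}$ depending holomorphically on $\kappa\in\mathcal W$, linearly independent for every $\kappa\in\mathcal W$, with $\mathcal A(\kappa)e_k(\kappa)=\zeta_k(\kappa)e_k(\kappa)$ for all $\kappa\in\mathcal W$ and all $k$. (3) (Trace estimate) There is $C>0$ such that for all $\Delta t\in\,]0,1]$ (with $\Delta x=\Delta t/\lambda$) and all $\mathbb C^N$-valued solutions of the Cauchy problem $$V_j^{n+1}=\sum_{\sigma=0}^{s}Q_\sigma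 V_j^{n-\sigma}\quad(j\in\mathbb Z,\ n\ge s),\qquad V_j^n=f_j^n\quad(j\in\mathbb Z,\ 0\le n\le s),$$ there holds $$\sum_{n\ge0}\Delta t\,|V_0^n|^2\le C\sum_{n=0}^{s}\sum_{j\in\mathbb Z}\Delta x\,|f_j^n|^2,$$ where both sides are elements of $[0,+\infty]$. Then the discretization is non-glancing: whenever $|\underline\kappa|=1$ and $\underline z$ with $|\underline z|=1$ is an eigenvalue of $\mathcal A(\underline\kappa)$ of algebraic multiplicity $\underline\alpha$, the holomorphic eigenvalues $\zeta_1,\dots,\zeta_{\underline\alpha}$ of $\mathcal A(\kappa)$ close to $\underline z$ for $\kappa$ close to $\underline\kappa$, as in (2), satisfy $\zeta_k'(\underline\kappa)\ne0$ for all $k=1,\dots,\underline\alpha$. Equivalently, none of the group velocities $-\underline\kappa\,\zeta_k'(\underline\kappa)/(\lambda\,\underline z)$ vanishes. -/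

import Mathlib

open scoped Matrix ENNReal Topology

noncomputable section

namespace DiscreteCauchy

/-- The coefficients of a constant coefficient, explicit finite difference operator acting on
`ℂ^N`-valued sequences on `ℤ`, with `s + 2` time levels and spatial stencil `-r, …, p`:
real `N × N` matrices `A ℓ σ`, `-r ≤ ℓ ≤ p`, `0 ≤ σ ≤ s`
(the values of `A` for `ℓ` outside of the stencil are never used). -/
structure Scheme (N s : ℕ) where
  r : ℤ
  p : ℤ
  A : ℤ → Fin (s + 1) → Matrix (Fin N) (Fin N) ℝ

namespace Scheme

variable {N s : ℕ} (S : Scheme N s)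

/-- The matrix `A_{ℓ,σ}`, seen as a complex matrix. -/
def coeff (ℓ : ℤ) (σ : Fin (s + 1)) : Matrix (Fin N) (Fin N) ℂ :=
  (S.A ℓ σ).map (fun x : ℝ => (x : ℂ))

/-- The operator `Q_σ = ∑_{ℓ=-r}^{p} A_{ℓ,σ} T^ℓ`, with `(T^ℓ v)_j = v_{j+ℓ}`. -/
def Q (σ : Fin (s + 1)) (v : ℤ → Fin N → ℂ) : ℤ → Fin N → ℂ :=
  fun j => ∑ ℓ ∈ Finset.Icc (-S.r) S.p, S.coeff ℓ σ *ᵥ v (j + ℓ)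

/-- The symbol `∑_{ℓ=-r}^{p} κ^ℓ A_{ℓ,σ}` of `Q_σ`. -/
def symbol (σ : Fin (s + 1)) (κ : ℂ) : Matrix (Fin N) (Fin N) ℂ :=
  ∑ ℓ ∈ Finset.Icc (-S.r) S.p, κ ^ ℓ • S.coeff ℓ σ

/-- The amplification matrix: the block companion matrix of size `N (s + 1)` whose first block
row is made of the symbols of `Q_0, …, Q_s`, with identity blocks below the diagonal. -/
def amplification (κ : ℂ) : Matrix (Fin (s + 1) × Fin N) (Fin (s + 1) × Fin N) ℂ :=
  Matrix.of fun a b =>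
    if a.1 = 0 then S.symbol b.1 κ a.2 b.2
    else if (a.1 : ℕ) = (b.1 : ℕ) + 1 ∧ a.2 = b.2 then 1 else 0

/-- Stability of the discrete Cauchy problem: the amplification matrix is power bounded,
uniformly on the unit circle (in the operator norm for the Hermitian norm of `ℂ^{N(s+1)}`). -/
def Stable : Prop :=
  ∃ C : ℝ, 0 < C ∧ ∀ (n : ℕ) (η : ℝ),
    ‖Matrix.toEuclideanCLM (𝕜 := ℂ)
        (S.amplification (Complex.exp (Complex.I * (η : ℂ))) ^ n)‖ ≤ C

/-- `z₀` is an eigenvalue of modulus one of the amplification matrix at the point `κ₀` of the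
unit circle. -/
def IsUnitEigenvalue (κ₀ z₀ : ℂ) : Prop :=
  ‖κ₀‖ = 1 ∧ ‖z₀‖ = 1 ∧ z₀ ∈ spectrum ℂ (S.amplification κ₀)

/-- The algebraic multiplicity of `z₀` as an eigenvalue of the amplification matrix at `κ₀`. -/
def algMult (κ₀ z₀ : ℂ) : ℕ :=
  (S.amplification κ₀).charpoly.rootMultiplicity z₀

/-- The functions `ζ_1, …, ζ_α` are holomorphic on the open neighborhood `W` of `κ₀`, are equal to
`z₀` at `κ₀`, and are the eigenvalues of the amplification matrix close to `z₀`: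
`det (z I - 𝒜(κ)) = ϑ(κ,z) ∏_k (z - ζ_k(κ))` in a neighborhood `O` of `(κ₀, z₀)`,
where `ϑ` is holomorphic and `ϑ(κ₀, z₀) ≠ 0`. -/
def IsEigenvalueFamily (κ₀ z₀ : ℂ) (W : Set ℂ) (ζ : Fin (S.algMult κ₀ z₀) → ℂ → ℂ) : Prop :=
  IsOpen W ∧ κ₀ ∈ W ∧ (0 : ℂ) ∉ W ∧
  (∀ k, DifferentiableOn ℂ (ζ k) W) ∧
  (∀ k, ζ k κ₀ = z₀) ∧
  ∃ (O : Set (ℂ × ℂ)) (ϑ : ℂ × ℂ → ℂ),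
    IsOpen O ∧ (κ₀, z₀) ∈ O ∧ (∀ x ∈ O, x.1 ∈ W) ∧
    DifferentiableOn ℂ ϑ O ∧ ϑ (κ₀, z₀) ≠ 0 ∧
    ∀ κ z : ℂ, (κ, z) ∈ O →
      (z • (1 : Matrix (Fin (s + 1) × Fin N) (Fin (s + 1) × Fin N) ℂ)
        - S.amplification κ).det = ϑ (κ, z) * ∏ k, (z - ζ k κ)

/-- Geometrically regular operator: near every eigenvalue of modulus one over the unit circle,
the eigenvalues split holomorphically, with holomorphic and linearly independent eigenvectors. -/
def GeometricallyRegular : Prop :=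
  ∀ κ₀ z₀ : ℂ, S.IsUnitEigenvalue κ₀ z₀ →
    ∃ (W : Set ℂ) (ζ : Fin (S.algMult κ₀ z₀) → ℂ → ℂ)
      (e : Fin (S.algMult κ₀ z₀) → ℂ → (Fin (s + 1) × Fin N → ℂ)),
      S.IsEigenvalueFamily κ₀ z₀ W ζ ∧
      (∀ k, DifferentiableOn ℂ (e k) W) ∧
      (∀ κ ∈ W, LinearIndependent ℂ (fun k => e k κ)) ∧
      ∀ κ ∈ W, ∀ k, S.amplification κ *ᵥ e k κ = ζ k κ • e k κ

/-- Non-glancing discretization: near every eigenvalue `z₀` of modulus one over a point `κ₀` of the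
unit circle, the eigenvalues close to `z₀` are given by holomorphic functions of `κ`, and these
functions (the family is unique up to the ordering and the domain) have nonzero derivatives
at `κ₀`. -/
def NonGlancing : Prop :=
  ∀ κ₀ z₀ : ℂ, S.IsUnitEigenvalue κ₀ z₀ →
    (∃ (W : Set ℂ) (ζ : Fin (S.algMult κ₀ z₀) → ℂ → ℂ), S.IsEigenvalueFamily κ₀ z₀ W ζ) ∧
    ∀ (W : Set ℂ) (ζ : Fin (S.algMult κ₀ z₀) → ℂ → ℂ),
      S.IsEigenvalueFamily κ₀ z₀ W ζ → ∀ k, deriv (ζ k) κ₀ ≠ 0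

/-- `V`, where `V n j` stands for `V_j^n`, is the solution of the fully discrete Cauchy problem
on `ℤ` with initial data `f^0, …, f^s`. -/
def IsCauchySolution (f : Fin (s + 1) → ℤ → Fin N → ℂ) (V : ℕ → ℤ → Fin N → ℂ) : Prop :=
  (∀ n : ℕ, s ≤ n → ∀ j : ℤ, V (n + 1) j = ∑ σ : Fin (s + 1), S.Q σ (V (n - (σ : ℕ))) j) ∧
  ∀ (n : Fin (s + 1)) (j : ℤ), V n j = f n j

/-- The trace estimate
`∑_{n ≥ 0} Δt |V_0^n|² ≤ C ∑_{n=0}^{s} ∑_{j ∈ ℤ} Δx |f_j^n|²`, with `Δx = Δt / lam`, for all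
solutions of the Cauchy problem, with `C` independent of `Δt ∈ ]0,1]` and of the solution.
The sums are taken in `[0, ∞]` (so that there is no constraint if `f` is not square summable,
and the left side is finite if `f` is square summable), and `|·|` is the Hermitian norm. -/
def TraceEstimate (lam : ℝ) : Prop :=
  ∃ C : ℝ, 0 < C ∧ ∀ Δt : ℝ, 0 < Δt → Δt ≤ 1 →
    ∀ (f : Fin (s + 1) → ℤ → Fin N → ℂ) (V : ℕ → ℤ → Fin N → ℂ), S.IsCauchySolution f V →
      ∑' n : ℕ, ENNReal.ofReal Δt * ‖WithLp.toLp 2 (V n 0)‖ₑ ^ 2 ≤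
        ENNReal.ofReal C *
          ∑ n : Fin (s + 1), ∑' j : ℤ,
            ENNReal.ofReal (Δt / lam) * ‖WithLp.toLp 2 (f n j)‖ₑ ^ 2

end Scheme

end DiscreteCauchy

end

/-!
A vanishing derivative of an eigenvalue contradicts the trace estimate, because wave packets
with zero group velocity stay at `j = 0` for too long.

Let `ζ(κ)` be a holomorphic eigenvalue of the amplification matrix with holomorphic eigenvector
`e(κ)`, let `ζ(κ₀) = z₀` with `κ₀ = e^{iη₀}` and `z₀` of modulus one, and suppose `ζ'(κ₀) = 0`.
Let `v(κ) ≠ 0` be the last block of `e(κ)`. By the companion structure the wave packets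
`V_j^n = ∫_{|η - η₀| ≤ ε} e^{ijη} ζ(e^{iη})^n v(e^{iη}) dη` solve the Cauchy problem
(`isCauchySolution_wavePacket`). Stability gives `|ζ(e^{iη})| ≤ 1`, so by Bessel's inequality the
`ℓ²` norm squared of the initial data is `O(ε)` (`tsum_sq_enorm_wavePacket_le`). On the other
hand, for every `δ > 0` and `ε` small, `|ζ(e^{iη}) - z₀| ≤ δ ε` on the arc, so that
`ζ(e^{iη})^n` stays close to `z₀^n`, and `|V_0^n| ≥ c ε`, for all `n ≤ 1 / (5 δ ε)`
(`le_norm_integral_pow_mul`). Hence `∑ |V_0^n|² ≥ c² ε / (5 δ)`, and the trace estimate with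
`Δt = 1` bounds `1 / δ` by a constant independent of `ε` and `δ` (`exists_forall_sq_norm_le`),
a contradiction as `δ → 0`.

The eigenvectors are only given for one family of eigenvalues at `κ₀`. Any other family has the
same germs up to the ordering, by the identity theorem (`IsEigenvalueFamily.exists_eventuallyEq`).
-/

open MeasureTheory Filter Set

namespace DiscreteCauchy

/-! ### Bessel's inequality on an arc -/

/-- Bessel's inequality for a function supported in an arc `[a, b]` of the circle, in terms of a
uniform bound on the function. -/
lemma tsum_sq_enorm_integral_le {a b K : ℝ} (hab : a ≤ b) (hb : b ≤ a + 2 * Real.pi)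
    {g : ℝ → ℂ} (hg : ContinuousOn g (Icc a b)) (hK : ∀ η ∈ Icc a b, ‖g η‖ ≤ K) :
    ∑' j : ℤ, ‖∫ η in a..b, Complex.exp (Complex.I * (η : ℂ)) ^ j * g η‖ₑ ^ 2 ≤
      ENNReal.ofReal (2 * Real.pi * (b - a) * K ^ 2) := by
  have hpi := Real.pi_pos
  have hT : a < a + 2 * Real.pi := by linarith
  have hsub : Ioc a b ⊆ Ioc a (a + 2 * Real.pi) := Ioc_subset_Ioc_right hb
  set f : ℝ → ℂ := (Ioc a b).indicator g with hf
  have hmem : MemLp f 2 (volume.restrict (Ioc a (a + 2 * Real.pi))) := by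
    refine (memLp_indicator_iff_restrict measurableSet_Ioc).2 ?_
    rw [Measure.restrict_restrict measurableSet_Ioc, inter_eq_left.2 hsub]
    refine MemLp.of_bound ((hg.mono Ioc_subset_Icc_self).aestronglyMeasurable
      measurableSet_Ioc) K ?_
    filter_upwards [ae_restrict_mem measurableSet_Ioc] with η hη
    exact hK η (Ioc_subset_Icc_self hη)
  have hcoeff (j : ℤ) : ∫ η in a..b, Complex.exp (Complex.I * (η : ℂ)) ^ j * g η =
      (2 * Real.pi) * fourierCoeffOn hT f (-j) := by
    rw [fourierCoeffOn_eq_integral, intervalIntegral.integral_of_le hab,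
      intervalIntegral.integral_of_le hT.le, Complex.real_smul, ← mul_assoc]
    have h1 : (2 * (Real.pi : ℂ)) * ((1 / (a + 2 * Real.pi - a) : ℝ) : ℂ) = 1 := by
      have : (Real.pi : ℂ) ≠ 0 := by exact_mod_cast hpi.ne'
      push_cast
      field_simp
      ring
    rw [h1, one_mul, neg_neg]
    have h2 : ∀ η : ℝ, fourier j (η : AddCircle (a + 2 * Real.pi - a)) • f η =
        (Ioc a b).indicator (fun η : ℝ => Complex.exp (Complex.I * (η : ℂ)) ^ j * g η) η := by
      intro η
      by_cases h : η ∈ Ioc a b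
      · rw [hf, indicator_of_mem h, indicator_of_mem h, fourier_coe_apply, smul_eq_mul,
          ← Complex.exp_int_mul]
        congr 2
        have : (Real.pi : ℂ) ≠ 0 := by exact_mod_cast hpi.ne'
        push_cast
        field_simp
        ring
      · rw [hf, indicator_of_notMem h, indicator_of_notMem h, smul_zero]
    simp_rw [h2]
    rw [setIntegral_indicator measurableSet_Ioc, inter_eq_right.2 hsub]
  have hsum := ((Equiv.neg ℤ).hasSum_iff.2 (hasSum_sq_fourierCoeffOn hT hmem)).mul_left
    ((2 * Real.pi) ^ 2)
  have hint : ∫ x in a..(a + 2 * Real.pi), ‖f x‖ ^ 2 ≤ (b - a) * K ^ 2 := by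
    have h3 : ∀ x, ‖f x‖ ^ 2 = (Ioc a b).indicator (fun x => ‖g x‖ ^ 2) x := by
      intro x
      by_cases h : x ∈ Ioc a b <;> simp [hf, h]
    simp_rw [h3]
    rw [intervalIntegral.integral_of_le hT.le, setIntegral_indicator measurableSet_Ioc,
      inter_eq_right.2 hsub, ← intervalIntegral.integral_of_le hab]
    calc ∫ x in a..b, ‖g x‖ ^ 2 ≤ ∫ _ in a..b, K ^ 2 := by
          refine intervalIntegral.integral_mono_on hab ?_ (by simp) ?_
          · exact ContinuousOn.intervalIntegrable_of_Icc hab (hg.norm.pow 2)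
          · intro x hx
            exact pow_le_pow_left₀ (norm_nonneg _) (hK x hx) 2
      _ = (b - a) * K ^ 2 := by simp
  have hterm (j : ℤ) : ‖∫ η in a..b, Complex.exp (Complex.I * (η : ℂ)) ^ j * g η‖ₑ ^ 2 =
      ENNReal.ofReal ((2 * Real.pi) ^ 2 *
        ((fun i => ‖fourierCoeffOn hT f i‖ ^ 2) ∘ (Equiv.neg ℤ)) j) := by
    rw [hcoeff, ← ofReal_norm, ← ENNReal.ofReal_pow (norm_nonneg _), norm_mul, mul_pow]
    congr 2
    simp [abs_of_pos hpi]
  simp_rw [hterm]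
  rw [← ENNReal.ofReal_tsum_of_nonneg (fun j => by simp only [Function.comp_apply]; positivity)
    hsum.summable, hsum.tsum_eq, smul_eq_mul]
  refine ENNReal.ofReal_le_ofReal ?_
  calc (2 * Real.pi) ^ 2 * ((a + 2 * Real.pi - a)⁻¹ * ∫ x in a..(a + 2 * Real.pi), ‖f x‖ ^ 2)
      = 2 * Real.pi * ∫ x in a..(a + 2 * Real.pi), ‖f x‖ ^ 2 := by
        rw [add_sub_cancel_left]
        field_simp
    _ ≤ 2 * Real.pi * ((b - a) * K ^ 2) := by gcongr
    _ = _ := by ring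

/-! ### Slow variation of a wave packet at a fixed point -/

lemma norm_pow_sub_pow_le {x y : ℂ} (hx : ‖x‖ ≤ 1) (hy : ‖y‖ ≤ 1) (n : ℕ) :
    ‖x ^ n - y ^ n‖ ≤ n * ‖x - y‖ := by
  induction n with
  | zero => simp
  | succ n ih =>
    have h : x ^ (n + 1) - y ^ (n + 1) = x * (x ^ n - y ^ n) + (x - y) * y ^ n := by ring
    rw [h]
    calc ‖x * (x ^ n - y ^ n) + (x - y) * y ^ n‖
        ≤ ‖x‖ * ‖x ^ n - y ^ n‖ + ‖x - y‖ * ‖y‖ ^ n := by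
          refine (norm_add_le _ _).trans ?_
          rw [norm_mul, norm_mul, norm_pow]
      _ ≤ 1 * (n * ‖x - y‖) + ‖x - y‖ * 1 := by
          gcongr
          exact pow_le_one₀ (norm_nonneg _) hy
      _ = ((n + 1 : ℕ) : ℝ) * ‖x - y‖ := by push_cast; ring

/-- As long as `n` times the oscillation of `Z` on `[η₀ - ε, η₀ + ε]` is at most `1 / 5`, the powers
`Z ^ n` have almost constant phase there, and the integral of `Z ^ n * w` is not small. -/
lemma le_norm_integral_pow_mul {η₀ ε d : ℝ} (hε : 0 ≤ ε) {Z w : ℝ → ℂ} {z₀ w₀ : ℂ}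
    (hZc : ContinuousOn Z (Icc (η₀ - ε) (η₀ + ε))) (hwc : ContinuousOn w (Icc (η₀ - ε) (η₀ + ε)))
    (hz₀ : ‖z₀‖ = 1) (hZ : ∀ η ∈ Icc (η₀ - ε) (η₀ + ε), ‖Z η‖ ≤ 1)
    (hd : ∀ η ∈ Icc (η₀ - ε) (η₀ + ε), ‖Z η - z₀‖ ≤ d)
    (hw : ∀ η ∈ Icc (η₀ - ε) (η₀ + ε), ‖w η - w₀‖ ≤ ‖w₀‖ / 4) {n : ℕ} (hn : n * d ≤ 1 / 5) :
    ε * ‖w₀‖ ≤ ‖∫ η in (η₀ - ε)..(η₀ + ε), Z η ^ n * w η‖ := by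
  have hle : η₀ - ε ≤ η₀ + ε := by linarith
  have hpt : ∀ η ∈ Icc (η₀ - ε) (η₀ + ε), ‖Z η ^ n * w η - z₀ ^ n * w₀‖ ≤ ‖w₀‖ / 2 := by
    intro η hη
    have hwb : ‖w η‖ ≤ 5 / 4 * ‖w₀‖ := by
      have := norm_add_le (w η - w₀) w₀
      rw [sub_add_cancel] at this
      linarith [hw η hη]
    have hZn : ‖Z η ^ n - z₀ ^ n‖ ≤ 1 / 5 :=
      (norm_pow_sub_pow_le (hZ η hη) hz₀.le n).trans
        ((mul_le_mul_of_nonneg_left (hd η hη) n.cast_nonneg).trans hn)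
    have h : Z η ^ n * w η - z₀ ^ n * w₀ = (Z η ^ n - z₀ ^ n) * w η + z₀ ^ n * (w η - w₀) := by
      ring
    rw [h]
    calc _ ≤ ‖Z η ^ n - z₀ ^ n‖ * ‖w η‖ + ‖w η - w₀‖ := by
          refine (norm_add_le _ _).trans ?_
          rw [norm_mul, norm_mul, norm_pow, hz₀, one_pow, one_mul]
      _ ≤ 1 / 5 * (5 / 4 * ‖w₀‖) + ‖w₀‖ / 4 := by
          gcongr
          exact hw η hη
      _ = ‖w₀‖ / 2 := by ring
  have hdiff : ‖∫ η in (η₀ - ε)..(η₀ + ε), (Z η ^ n * w η - z₀ ^ n * w₀)‖ ≤ ε * ‖w₀‖ := by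
    refine (intervalIntegral.norm_integral_le_of_norm_le_const (C := ‖w₀‖ / 2) ?_).trans ?_
    · intro η hη
      rw [uIoc_of_le hle] at hη
      exact hpt η (Ioc_subset_Icc_self hη)
    · rw [abs_of_nonneg (by linarith)]
      apply le_of_eq
      ring
  have hint : IntervalIntegrable (fun η => Z η ^ n * w η) volume (η₀ - ε) (η₀ + ε) :=
    ((hZc.pow n).mul hwc).intervalIntegrable_of_Icc hle
  rw [intervalIntegral.integral_sub hint intervalIntegrable_const,
    intervalIntegral.integral_const] at hdiff
  have hconst : ‖(η₀ + ε - (η₀ - ε)) • (z₀ ^ n * w₀)‖ = 2 * (ε * ‖w₀‖) := by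
    rw [norm_smul, norm_mul, norm_pow, hz₀, one_pow, one_mul, Real.norm_of_nonneg (by linarith)]
    ring
  have := norm_sub_norm_le ((η₀ + ε - (η₀ - ε)) • (z₀ ^ n * w₀))
    (∫ η in (η₀ - ε)..(η₀ + ε), Z η ^ n * w η)
  rw [norm_sub_rev, hconst] at this
  linarith

namespace Scheme

variable {N s : ℕ} {S : Scheme N s}

/-! ### Eigenvectors of the amplification matrix -/

lemma eigenvector_succ {κ z : ℂ} {e : Fin (s + 1) × Fin N → ℂ}
    (h : S.amplification κ *ᵥ e = z • e) {a b : Fin (s + 1)} (hab : (b : ℕ) = (a : ℕ) + 1)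
    (i : Fin N) : e (a, i) = z * e (b, i) := by
  have hb : b ≠ 0 := by
    intro h0
    simp [h0] at hab
  have h1 := congrFun h (b, i)
  rw [Matrix.mulVec, dotProduct, Finset.sum_eq_single (a, i)] at h1
  · simpa [amplification, hb, hab] using h1
  · rintro ⟨c, k⟩ - hne
    have : ¬ ((b : ℕ) = (c : ℕ) + 1 ∧ i = k) := by
      rintro ⟨h2, rfl⟩
      apply hne
      have : c = a := Fin.ext (by omega)
      rw [this]
    simp only [amplification, Matrix.of_apply]
    rw [if_neg hb, if_neg this, zero_mul]
  · simp

/-- The eigenvectors of a block companion matrix are determined by their last block. -/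
lemma eigenvector_eq_pow_mul {κ z : ℂ} {e : Fin (s + 1) × Fin N → ℂ}
    (h : S.amplification κ *ᵥ e = z • e) (a : Fin (s + 1)) (i : Fin N) :
    e (a, i) = z ^ (s - (a : ℕ)) * e (Fin.last s, i) := by
  induction a using Fin.reverseInduction with
  | last => simp
  | cast a ih =>
    rw [eigenvector_succ h (a := a.castSucc) (b := a.succ) (by simp), ih, ← mul_assoc, ← pow_succ']
    congr 2
    have := a.isLt
    simp only [Fin.val_succ, Fin.val_castSucc]
    omega

lemma exists_last_ne_zero {κ z : ℂ} {e : Fin (s + 1) × Fin N → ℂ}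
    (h : S.amplification κ *ᵥ e = z • e) (he : e ≠ 0) : ∃ i, e (Fin.last s, i) ≠ 0 := by
  by_contra! h0
  apply he
  ext ⟨a, i⟩
  rw [eigenvector_eq_pow_mul h, h0, mul_zero, Pi.zero_apply]

/-- The last block `v` of an eigenvector solves the polynomial eigenvalue problem
`z ^ (s + 1) v = ∑ σ, z ^ (s - σ) Q_σ(κ) v`. -/
lemma sum_symbol_mulVec {κ z : ℂ} {e : Fin (s + 1) × Fin N → ℂ}
    (h : S.amplification κ *ᵥ e = z • e) (i : Fin N) :
    ∑ σ : Fin (s + 1), z ^ (s - (σ : ℕ)) *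
      ∑ k, S.symbol σ κ i k * e (Fin.last s, k) = z ^ (s + 1) * e (Fin.last s, i) := by
  have h1 := congrFun h (0, i)
  rw [Matrix.mulVec, dotProduct, Fintype.sum_prod_type] at h1
  rw [Pi.smul_apply, smul_eq_mul, eigenvector_eq_pow_mul h 0 i, ← mul_assoc, ← pow_succ'] at h1
  simp only [Fin.val_zero, Nat.sub_zero] at h1
  rw [← h1]
  refine Finset.sum_congr rfl fun σ _ => ?_
  rw [Finset.mul_sum]
  refine Finset.sum_congr rfl fun k _ => ?_
  rw [eigenvector_eq_pow_mul h σ k]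
  simp only [amplification, Matrix.of_apply, if_true]
  ring

/-- Power boundedness confines the eigenvalues over the unit circle to the closed unit disk. -/
lemma Stable.norm_eigenvalue_le_one (hS : S.Stable) {η : ℝ} {z : ℂ}
    {e : Fin (s + 1) × Fin N → ℂ}
    (h : S.amplification (Complex.exp (Complex.I * (η : ℂ))) *ᵥ e = z • e) (he : e ≠ 0) :
    ‖z‖ ≤ 1 := by
  obtain ⟨C, -, hC⟩ := hS
  have hpow (n : ℕ) :
      S.amplification (Complex.exp (Complex.I * (η : ℂ))) ^ n *ᵥ e = z ^ n • e := by
    induction n with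
    | zero => simp
    | succ n ih => rw [pow_succ, ← Matrix.mulVec_mulVec, h, Matrix.mulVec_smul, ih, smul_smul,
        pow_succ']
  have he' : 0 < ‖WithLp.toLp 2 e‖ := by
    rw [norm_pos_iff]
    exact fun h0 => he (by simpa using h0)
  have hb (n : ℕ) : ‖z‖ ^ n ≤ C := by
    have h1 := ContinuousLinearMap.le_of_opNorm_le _ (hC n η) (WithLp.toLp 2 e)
    rw [Matrix.toEuclideanCLM_toLp, hpow, WithLp.toLp_smul, norm_smul, norm_pow] at h1
    exact le_of_mul_le_mul_right h1 he'
  by_contra! hz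
  obtain ⟨n, hn⟩ := pow_unbounded_of_one_lt C hz
  exact absurd (hb n) (not_le.2 hn)

/-! ### Wave packets -/

/-- The superposition, over the frequencies `η ∈ [a, b]`, of the plane waves
`(n, j) ↦ Z(η)^n e^{ijη} w(η)`. -/
noncomputable def wavePacket (a b : ℝ) (Z : ℝ → ℂ) (w : ℝ → Fin N → ℂ) (n : ℕ) (j : ℤ) : Fin N → ℂ :=
  fun i => ∫ η in a..b, Complex.exp (Complex.I * (η : ℂ)) ^ j * (Z η ^ n * w η i)

lemma isCauchySolution_wavePacket {a b : ℝ} (hab : a ≤ b) {Z : ℝ → ℂ}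
    {e : ℝ → Fin (s + 1) × Fin N → ℂ} (hZ : ContinuousOn Z (Icc a b))
    (he : ContinuousOn e (Icc a b))
    (h : ∀ η ∈ Icc a b,
      S.amplification (Complex.exp (Complex.I * (η : ℂ))) *ᵥ e η = Z η • e η) :
    S.IsCauchySolution (fun n => wavePacket a b Z (fun η i => e η (Fin.last s, i)) n)
      (wavePacket a b Z (fun η i => e η (Fin.last s, i))) := by
  refine ⟨fun n hn j => ?_, fun n j => rfl⟩
  have hint (m : ℕ) (l : ℤ) (c : ℂ) (k : Fin N) : IntervalIntegrable (fun η : ℝ => c *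
      (Complex.exp (Complex.I * (η : ℂ)) ^ l * (Z η ^ m * e η (Fin.last s, k)))) volume a b := by
    refine ContinuousOn.intervalIntegrable_of_Icc hab ?_
    have hexp : Continuous fun η : ℝ => Complex.exp (Complex.I * (η : ℂ)) ^ l :=
      Continuous.zpow₀ (by fun_prop) l fun η => Or.inl (Complex.exp_ne_zero _)
    exact continuousOn_const.mul (hexp.continuousOn.mul
      ((hZ.pow m).mul (continuousOn_pi.1 he _)))
  ext i
  simp only [Finset.sum_apply, Q, Matrix.mulVec, dotProduct, wavePacket]
  simp_rw [← intervalIntegral.integral_const_mul]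
  simp_rw [← intervalIntegral.integral_finsetSum fun k _ => hint _ _ _ k]
  have hint2 (m : ℕ) (l : ℤ) (c : Fin N → ℂ) : IntervalIntegrable (fun η : ℝ => ∑ k, c k *
      (Complex.exp (Complex.I * (η : ℂ)) ^ l * (Z η ^ m * e η (Fin.last s, k)))) volume a b := by
    simpa only [Finset.sum_fn] using IntervalIntegrable.sum Finset.univ (f := fun k η => c k *
      (Complex.exp (Complex.I * ((η : ℝ) : ℂ)) ^ l * (Z η ^ m * e η (Fin.last s, k))))
      fun k _ => hint m l (c k) k
  simp_rw [← intervalIntegral.integral_finsetSum fun l _ => hint2 _ _ _]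
  rw [← intervalIntegral.integral_finsetSum]
  · refine intervalIntegral.integral_congr fun η hη => ?_
    rw [uIcc_of_le hab] at hη
    have h1 := sum_symbol_mulVec (h η hη) i
    have h2 : Z η ^ (n + 1) = Z η ^ (n - s) * Z η ^ (s + 1) := by
      rw [← pow_add]
      congr 1
      omega
    rw [h2, mul_assoc (Z η ^ (n - s)), ← h1, Finset.mul_sum, Finset.mul_sum]
    refine Finset.sum_congr rfl fun σ _ => ?_
    have h3 : Z η ^ (n - (σ : ℕ)) = Z η ^ (n - s) * Z η ^ (s - (σ : ℕ)) := by
      rw [← pow_add]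
      congr 1
      have := σ.isLt
      omega
    simp only [symbol, Matrix.sum_apply, Matrix.smul_apply, smul_eq_mul]
    rw [Finset.sum_comm, Finset.mul_sum, Finset.mul_sum, Finset.mul_sum]
    refine Finset.sum_congr rfl fun k _ => ?_
    rw [Finset.sum_mul, Finset.mul_sum, Finset.mul_sum, Finset.mul_sum]
    refine Finset.sum_congr rfl fun l _ => ?_
    rw [h3, zpow_add₀ (Complex.exp_ne_zero _)]
    ring
  · intro σ _
    simpa only [Finset.sum_fn] using IntervalIntegrable.sum (Finset.Icc (-S.r) S.p)
      (f := fun l η => ∑ k, S.coeff l σ i k * (Complex.exp (Complex.I * ((η : ℝ) : ℂ)) ^ (j + l) *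
        (Z η ^ (n - (σ : ℕ)) * e η (Fin.last s, k)))) fun l _ => hint2 _ _ _

lemma tsum_sq_enorm_wavePacket_le {a b K : ℝ} (hab : a ≤ b) (hb : b ≤ a + 2 * Real.pi)
    {Z : ℝ → ℂ} {w : ℝ → Fin N → ℂ} (hZ : ContinuousOn Z (Icc a b))
    (hw : ContinuousOn w (Icc a b)) (hZ1 : ∀ η ∈ Icc a b, ‖Z η‖ ≤ 1)
    (hK : ∀ η ∈ Icc a b, ‖w η‖ ≤ K) (n : ℕ) :
    ∑' j : ℤ, ‖WithLp.toLp 2 (wavePacket a b Z w n j)‖ₑ ^ 2 ≤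
      ENNReal.ofReal (N * (2 * Real.pi * (b - a) * K ^ 2)) := by
  have h1 (v : Fin N → ℂ) : ‖WithLp.toLp 2 v‖ₑ ^ 2 = ∑ i, ‖v i‖ₑ ^ 2 := by
    rw [← ofReal_norm, ← ENNReal.ofReal_pow (norm_nonneg _), EuclideanSpace.norm_sq_eq,
      ENNReal.ofReal_sum_of_nonneg fun i _ => by positivity]
    refine Finset.sum_congr rfl fun i _ => ?_
    rw [ENNReal.ofReal_pow (norm_nonneg _), ofReal_norm]
  simp_rw [h1]
  rw [Summable.tsum_finsetSum fun i _ => ENNReal.summable]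
  calc _ ≤ ∑ i : Fin N, ENNReal.ofReal (2 * Real.pi * (b - a) * K ^ 2) := by
        refine Finset.sum_le_sum fun i _ => ?_
        refine tsum_sq_enorm_integral_le hab hb ((hZ.pow n).mul (continuousOn_pi.1 hw i)) ?_
        intro η hη
        rw [norm_mul, norm_pow]
        calc ‖Z η‖ ^ n * ‖w η i‖ ≤ 1 * K := by
              gcongr
              · exact pow_le_one₀ (norm_nonneg _) (hZ1 η hη)
              · exact (norm_le_pi_norm _ i).trans (hK η hη)
          _ = K := one_mul K
    _ = _ := by
        rw [Finset.sum_const, Finset.card_univ, Fintype.card_fin, nsmul_eq_mul,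
          ENNReal.ofReal_mul N.cast_nonneg, ENNReal.ofReal_natCast]

/-! ### The trace estimate excludes critical points of the eigenvalues -/

/-- The trace estimate applied to a packet with frequencies in `[η₀ - ε, η₀ + ε]` on which the
eigenvalue varies by at most `δ ε`: the packet stays at the origin during a time of order
`1 / (δ ε)`, with an amplitude of order `ε` and an energy of order `ε`. -/
lemma exists_forall_sq_norm_le {lam : ℝ} (hlam : 0 < lam) (htrace : S.TraceEstimate lam) :
    ∃ C : ℝ, 0 ≤ C ∧ ∀ (η₀ ε δ K : ℝ) (Z : ℝ → ℂ) (e : ℝ → Fin (s + 1) × Fin N → ℂ) (z₀ : ℂ)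
      (i : Fin N), 0 < ε → ε ≤ Real.pi → 0 < δ → ‖z₀‖ = 1 →
      ContinuousOn Z (Icc (η₀ - ε) (η₀ + ε)) →
      ContinuousOn e (Icc (η₀ - ε) (η₀ + ε)) →
      (∀ η ∈ Icc (η₀ - ε) (η₀ + ε), ‖Z η‖ ≤ 1 ∧ ‖e η‖ ≤ K ∧ ‖Z η - z₀‖ ≤ δ * ε ∧
        ‖e η (Fin.last s, i) - e η₀ (Fin.last s, i)‖ ≤ ‖e η₀ (Fin.last s, i)‖ / 4 ∧
        S.amplification (Complex.exp (Complex.I * (η : ℂ))) *ᵥ e η = Z η • e η) →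
      ‖e η₀ (Fin.last s, i)‖ ^ 2 ≤ C * K ^ 2 * δ := by
  obtain ⟨C, hC, htr⟩ := htrace
  refine ⟨5 * (C * ((s + 1) * (1 / lam * (N * (4 * Real.pi))))), by positivity, ?_⟩
  intro η₀ ε δ K Z e z₀ i hε hεpi hδ hz₀ hZ he h
  have hab : η₀ - ε ≤ η₀ + ε := by linarith
  set w : ℝ → Fin N → ℂ := fun η k => e η (Fin.last s, k)
  have hwc : ContinuousOn w (Icc (η₀ - ε) (η₀ + ε)) :=
    continuousOn_pi.2 fun k => continuousOn_pi.1 he _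
  have hK : ∀ η ∈ Icc (η₀ - ε) (η₀ + ε), ‖w η‖ ≤ K := by
    intro η hη
    have hKe := (h η hη).2.1
    exact (pi_norm_le_iff_of_nonneg ((norm_nonneg _).trans hKe)).2 fun k =>
      (norm_le_pi_norm (e η) _).trans hKe
  have key := htr 1 one_pos le_rfl _ _
    (isCauchySolution_wavePacket hab hZ he fun η hη => (h η hη).2.2.2.2)
  set M : ℕ := ⌊1 / (5 * (δ * ε))⌋₊ + 1 with hM
  have hMlt : 1 / (5 * (δ * ε)) ≤ M := by
    rw [hM]
    push_cast
    exact (Nat.lt_floor_add_one _).le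
  have hlow : ∀ n ∈ Finset.range M, ENNReal.ofReal ((ε * ‖w η₀ i‖) ^ 2) ≤
      ENNReal.ofReal 1 * ‖WithLp.toLp 2 (wavePacket (η₀ - ε) (η₀ + ε) Z w n 0)‖ₑ ^ 2 := by
    intro n hn
    have hn' : (n : ℝ) ≤ 1 / (5 * (δ * ε)) := by
      rw [Finset.mem_range, hM, Nat.lt_succ_iff] at hn
      exact (Nat.le_floor_iff (by positivity)).1 hn
    have hnd : n * (δ * ε) ≤ 1 / 5 := by
      rw [le_div_iff₀ (by positivity)] at hn'
      linarith
    have h1 := le_norm_integral_pow_mul hε.le hZ (continuousOn_pi.1 hwc i) hz₀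
      (fun η hη => (h η hη).1) (fun η hη => (h η hη).2.2.1)
      (fun η hη => (h η hη).2.2.2.1) hnd
    have h2 : ∫ η in (η₀ - ε)..(η₀ + ε), Z η ^ n * w η i =
        wavePacket (η₀ - ε) (η₀ + ε) Z w n 0 i := by
      simp [wavePacket]
    rw [h2] at h1
    have h3 := h1.trans (PiLp.norm_apply_le (WithLp.toLp 2
      (wavePacket (η₀ - ε) (η₀ + ε) Z w n 0)) i)
    rw [ENNReal.ofReal_one, one_mul, ← ofReal_norm, ← ENNReal.ofReal_pow (norm_nonneg _)]
    exact ENNReal.ofReal_le_ofReal (pow_le_pow_left₀ (by positivity) h3 2)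
  have hleft := (Finset.sum_le_sum hlow).trans ((ENNReal.sum_le_tsum _).trans key)
  have hright : ENNReal.ofReal C * ∑ n : Fin (s + 1), ∑' j : ℤ, ENNReal.ofReal (1 / lam) *
      ‖WithLp.toLp 2 (wavePacket (η₀ - ε) (η₀ + ε) Z w n j)‖ₑ ^ 2 ≤
      ENNReal.ofReal (C * ((s + 1) *
        (1 / lam * (N * (2 * Real.pi * (η₀ + ε - (η₀ - ε)) * K ^ 2))))) := by
    rw [ENNReal.ofReal_mul hC.le]
    gcongr
    calc _ ≤ ∑ n : Fin (s + 1), ENNReal.ofReal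
          (1 / lam * (N * (2 * Real.pi * (η₀ + ε - (η₀ - ε)) * K ^ 2))) := by
          refine Finset.sum_le_sum fun n _ => ?_
          rw [ENNReal.tsum_mul_left, ENNReal.ofReal_mul (by positivity)]
          gcongr
          exact tsum_sq_enorm_wavePacket_le hab (by linarith) hZ hwc
            (fun η hη => (h η hη).1) hK n
      _ = _ := by
          rw [Finset.sum_const, Finset.card_univ, Fintype.card_fin, nsmul_eq_mul,
            ENNReal.ofReal_mul (p := (s : ℝ) + 1) (by positivity), ← ENNReal.ofReal_natCast]
          push_cast
          rfl
  have htot := hleft.trans hright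
  rw [Finset.sum_const, Finset.card_range, nsmul_eq_mul, ← ENNReal.ofReal_natCast,
    ← ENNReal.ofReal_mul (by positivity)] at htot
  have hd : (0 : ℝ) ≤ η₀ + ε - (η₀ - ε) := by linarith
  rw [ENNReal.ofReal_le_ofReal_iff (by positivity)] at htot
  have h5 : 1 / (5 * (δ * ε)) * (ε * ‖w η₀ i‖) ^ 2 ≤ _ :=
    (mul_le_mul_of_nonneg_right hMlt (by positivity)).trans htot
  have h6 : 1 / (5 * (δ * ε)) * (ε * ‖w η₀ i‖) ^ 2 = ε / (5 * δ) * ‖w η₀ i‖ ^ 2 := by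
    field_simp
  rw [h6] at h5
  have h7 : ‖w η₀ i‖ ^ 2 = 5 * δ / ε * (ε / (5 * δ) * ‖w η₀ i‖ ^ 2) := by
    field_simp
  change ‖w η₀ i‖ ^ 2 ≤ _
  rw [h7]
  refine (mul_le_mul_of_nonneg_left h5 (by positivity)).trans (le_of_eq ?_)
  field_simp
  ring

/-- A holomorphic eigenvalue of modulus one at `κ₀`, with a holomorphic eigenvector, is not
stationary at `κ₀`. -/
theorem deriv_eigenvalue_ne_zero {lam : ℝ} (hlam : 0 < lam) (hstable : S.Stable)
    (htrace : S.TraceEstimate lam) {κ₀ : ℂ} (hκ₀ : ‖κ₀‖ = 1) {W : Set ℂ} (hW : IsOpen W)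
    (hmem : κ₀ ∈ W) {ζ : ℂ → ℂ} {e : ℂ → Fin (s + 1) × Fin N → ℂ}
    (hζ : DifferentiableOn ℂ ζ W) (he : DifferentiableOn ℂ e W) (hz₀ : ‖ζ κ₀‖ = 1)
    (hne : ∀ κ ∈ W, e κ ≠ 0) (heig : ∀ κ ∈ W, S.amplification κ *ᵥ e κ = ζ κ • e κ) :
    deriv ζ κ₀ ≠ 0 := by
  intro hderiv
  obtain ⟨η₀, rfl⟩ : ∃ η₀ : ℝ, Complex.exp (Complex.I * (η₀ : ℂ)) = κ₀ := by
    refine ⟨Complex.arg κ₀, ?_⟩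
    have := Complex.norm_mul_exp_arg_mul_I κ₀
    rwa [hκ₀, Complex.ofReal_one, one_mul, mul_comm] at this
  set E : ℝ → ℂ := fun η => Complex.exp (Complex.I * (η : ℂ))
  have hEc : Continuous E := by fun_prop
  have hEd : HasDerivAt E (Complex.exp (Complex.I * (η₀ : ℂ)) * (Complex.I * 1)) η₀ :=
    (Complex.ofRealCLM.hasDerivAt.const_mul Complex.I).cexp
  have hZd : HasDerivAt (fun η => ζ (E η)) 0 η₀ := by
    have h1 : HasDerivAt ζ 0 (E η₀) := by
      rw [← hderiv]
      exact (hζ.differentiableAt (hW.mem_nhds hmem)).hasDerivAt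
    have h2 := h1.comp η₀ hEd
    rw [zero_mul] at h2
    exact h2
  obtain ⟨i, hi⟩ := exists_last_ne_zero (heig _ hmem) (hne _ hmem)
  obtain ⟨C, hC, hmain⟩ := exists_forall_sq_norm_le hlam htrace
  have hEW : ∀ᶠ η in 𝓝 η₀, E η ∈ W := hEc.continuousAt.eventually (hW.mem_nhds hmem)
  have hec : ContinuousAt (fun η => e (E η)) η₀ :=
    ContinuousAt.comp (f := E) (g := e)
      (he.differentiableAt (hW.mem_nhds hmem)).continuousAt hEc.continuousAt
  have hbound : ∀ᶠ η in 𝓝 η₀, ‖e (E η)‖ ≤ ‖e (E η₀)‖ + 1 :=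
    (hec.norm.eventually (gt_mem_nhds (lt_add_one _))).mono fun η h => h.le
  have hosc : ∀ᶠ η in 𝓝 η₀, ‖e (E η) (Fin.last s, i) - e (E η₀) (Fin.last s, i)‖ ≤
      ‖e (E η₀) (Fin.last s, i)‖ / 4 := by
    have h1 : ContinuousAt (fun η => e (E η) (Fin.last s, i)) η₀ := continuousAt_pi.1 hec _
    have h2 := h1.eventually (Metric.closedBall_mem_nhds _
      (show 0 < ‖e (E η₀) (Fin.last s, i)‖ / 4 from div_pos (norm_pos_iff.2 hi) (by norm_num)))
    filter_upwards [h2] with η hη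
    rw [← dist_eq_norm]
    exact hη
  have hδ : ∀ δ > 0, ‖e (E η₀) (Fin.last s, i)‖ ^ 2 ≤ C * (‖e (E η₀)‖ + 1) ^ 2 * δ := by
    intro δ hδ
    have hlittle := (hasDerivAt_iff_isLittleO.1 hZd).def hδ
    obtain ⟨ε, hε, hball⟩ := Metric.eventually_nhds_iff_ball.1
      (hEW.and (hbound.and (hosc.and hlittle)))
    have hr : 0 < min (ε / 2) Real.pi := lt_min (by linarith) Real.pi_pos
    have hsub : ∀ η ∈ Icc (η₀ - min (ε / 2) Real.pi) (η₀ + min (ε / 2) Real.pi),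
        |η - η₀| ≤ min (ε / 2) Real.pi ∧ η ∈ Metric.ball η₀ ε := by
      intro η hη
      have h1 : |η - η₀| ≤ min (ε / 2) Real.pi := abs_le.2 ⟨by linarith [hη.1], by linarith [hη.2]⟩
      refine ⟨h1, ?_⟩
      rw [Metric.mem_ball, Real.dist_eq]
      linarith [min_le_left (ε / 2) Real.pi]
    have hmaps : MapsTo E (Icc (η₀ - min (ε / 2) Real.pi) (η₀ + min (ε / 2) Real.pi)) W :=
      fun η hη => (hball η (hsub η hη).2).1
    refine hmain η₀ (min (ε / 2) Real.pi) δ (‖e (E η₀)‖ + 1) (fun η => ζ (E η))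
      (fun η => e (E η)) (ζ (E η₀)) i hr (min_le_right _ _) hδ hz₀
      (hζ.continuousOn.comp hEc.continuousOn hmaps) (he.continuousOn.comp hEc.continuousOn hmaps)
      fun η hη => ?_
    obtain ⟨h1, h2⟩ := hsub η hη
    obtain ⟨hηW, hηb, hηo, hηl⟩ := hball η h2
    refine ⟨hstable.norm_eigenvalue_le_one (heig _ hηW) (hne _ hηW), hηb, ?_, hηo, heig _ hηW⟩
    rw [smul_zero, sub_zero, Real.norm_eq_abs] at hηl
    exact hηl.trans (mul_le_mul_of_nonneg_left h1 hδ.le)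
  have hlim : Tendsto (fun δ : ℝ => C * (‖e (E η₀)‖ + 1) ^ 2 * δ) (𝓝[>] 0) (𝓝 0) := by
    have : Tendsto (fun δ : ℝ => C * (‖e (E η₀)‖ + 1) ^ 2 * δ) (𝓝 0)
        (𝓝 (C * (‖e (E η₀)‖ + 1) ^ 2 * 0)) := tendsto_id.const_mul _
    rw [mul_zero] at this
    exact this.mono_left nhdsWithin_le_nhds
  have hle := ge_of_tendsto hlim (eventually_nhdsWithin_of_forall fun δ h => hδ δ h)
  exact hi (norm_eq_zero.1 (pow_eq_zero_iff two_ne_zero |>.1 (le_antisymm hle (by positivity))))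

/-! ### Uniqueness of the family of eigenvalues -/

/-- The germs at `κ₀` of a family of holomorphic eigenvalues are unique up to the ordering. -/
lemma IsEigenvalueFamily.exists_eventuallyEq {κ₀ z₀ : ℂ} {W W' : Set ℂ}
    {ζ ζ' : Fin (S.algMult κ₀ z₀) → ℂ → ℂ} (h : S.IsEigenvalueFamily κ₀ z₀ W ζ)
    (h' : S.IsEigenvalueFamily κ₀ z₀ W' ζ') (k : Fin (S.algMult κ₀ z₀)) :
    ∃ l, ζ k =ᶠ[𝓝 κ₀] ζ' l := by
  obtain ⟨hW, hmem, -, hζ, hζ₀, O, ϑ, hO, hmO, -, -, -, hdet⟩ := h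
  obtain ⟨hW', hmem', -, hζ', -, O', ϑ', hO', hmO', -, hϑ', hϑ'0, hdet'⟩ := h'
  have hcont : ContinuousAt (fun κ => (κ, ζ k κ)) κ₀ :=
    continuousAt_id.prodMk ((hζ k).differentiableAt (hW.mem_nhds hmem)).continuousAt
  have hval : (κ₀, ζ k κ₀) = (κ₀, z₀) := by rw [hζ₀]
  have hevO : ∀ᶠ κ in 𝓝 κ₀, (κ, ζ k κ) ∈ O :=
    hcont.eventually (hO.mem_nhds (by simpa only [hval] using hmO))
  have hevO' : ∀ᶠ κ in 𝓝 κ₀, (κ, ζ k κ) ∈ O' :=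
    hcont.eventually (hO'.mem_nhds (by simpa only [hval] using hmO'))
  have hϑc : ContinuousAt (fun κ => ϑ' (κ, ζ k κ)) κ₀ := by
    refine ContinuousAt.comp (f := fun κ => (κ, ζ k κ)) (g := ϑ') ?_ hcont
    simp only [hval]
    exact (hϑ'.differentiableAt (hO'.mem_nhds hmO')).continuousAt
  have hevϑ : ∀ᶠ κ in 𝓝 κ₀, ϑ' (κ, ζ k κ) ≠ 0 := by
    refine hϑc.eventually_ne ?_
    simpa only [hval] using hϑ'0
  -- The two factorizations have the same zeros, so each value of `ζ k` is a value of some `ζ' l`.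
  have hex : ∀ᶠ κ in 𝓝 κ₀, ∃ l, ζ k κ = ζ' l κ := by
    filter_upwards [hevO, hevO', hevϑ] with κ h1 h2 h3
    have h4 := (hdet _ _ h1).symm.trans (hdet' _ _ h2)
    rw [Finset.prod_eq_zero (Finset.mem_univ k) (sub_self _), mul_zero, eq_comm,
      mul_eq_zero, or_iff_right h3, Finset.prod_eq_zero_iff] at h4
    obtain ⟨l, -, hl⟩ := h4
    exact ⟨l, sub_eq_zero.1 hl⟩
  -- By finiteness, one index `l` occurs on a set accumulating at `κ₀`.
  have hfreq : ∃ l, ∃ᶠ κ in 𝓝[≠] κ₀, ζ k κ = ζ' l κ := by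
    by_contra! hcon
    obtain ⟨κ, hκ, l, hl⟩ :=
      ((eventually_all.2 hcon).and (hex.filter_mono nhdsWithin_le_nhds)).exists
    exact hκ l hl
  obtain ⟨l, hl⟩ := hfreq
  exact ⟨l, (((hζ k).analyticAt (hW.mem_nhds hmem)).frequently_eq_iff_eventually_eq
    ((hζ' l).analyticAt (hW'.mem_nhds hmem'))).1 hl⟩

end Scheme

end DiscreteCauchy

theorem propositionA (N s : ℕ) (S : DiscreteCauchy.Scheme N s) (lam : ℝ) (hlam : 0 < lam)
    (hstable : S.Stable) (hregular : S.GeometricallyRegular)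
    (htrace : S.TraceEstimate lam) :
    S.NonGlancing := by
  intro κ₀ z₀ hunit
  obtain ⟨W', ζ', e, hfam', he, hli, heig⟩ := hregular κ₀ z₀ hunit
  refine ⟨⟨W', ζ', hfam'⟩, fun W ζ hfam k => ?_⟩
  obtain ⟨l, hl⟩ := hfam.exists_eventuallyEq hfam' k
  rw [hl.deriv_eq]
  have hz₀ : ‖ζ' l κ₀‖ = 1 := by rw [hfam'.2.2.2.2.1 l, hunit.2.1]
  exact DiscreteCauchy.Scheme.deriv_eigenvalue_ne_zero hlam hstable htrace hunit.1 hfam'.1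
    hfam'.2.1 (hfam'.2.2.2.1 l) (he l) hz₀ (fun κ hκ => (hli κ hκ).ne_zero l)
    fun κ hκ => heig κ hκ l
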